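/- **Notation.** Let $n\in\mathbb N$, $\bar y=(y_1,\dots,y_n)$, $y_0:=x$, and let $\Sigma$ be the $\mathbb R$-algebra of streams $\sigma=(\sigma(0),\sigma(1),\dots)\in\mathbb R^{\mathbb N}$ with componentwise sum and convolution product $(\sigma\times\tau)(i)=\sum_{j\le i}\sigma(j)\tau(i-j)$; let $X=(0,1,0,0,\dots)$. For $p\in\mathbb R[x,\bar y]$ and $\bar\sigma\in\Sigma^n$, $p(X,\bar\sigma)\in\Sigma$ is the image of $p$ under the $\mathbb R$-algebra homomorphism with $x\mapsto X$, $y_i\mapsto\sigma_i$. A *stream solution* of $\mathcal E=(p_1,\dots,p_n)\in\mathbb R[x,\bar y]^n$ is a $\bar\sigma\in\Sigma^n$ with $p_i(X,\bar\sigma)=0$ for all $i$. With new indeterminates $\bar y_0=(y_{01},\dots,y_{0n})$ and $\bar y'=(y'_1,\dots,y'_n)$, and with $y_{00}:=0$, the syntactic stream derivative $p\mapsto p'\in\mathbb R[x,\bar y_0,\bar y,\bar y']$ is the linear map given on monomials by $1'=0$, $x'=1$, $(y_i)'=y'_i$ and $(y_i\,m)'=y'_i\,m+y_{0i}\,m'$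 whenever $0\le i\le n$, $m\ne1$ and $y_i$ is the least variable of $y_i m$ in the order $x<y_1<\dots<y_n$ (with $y'_0$ read as $1$). There are unique $q_0,\dots,q_n\in\mathbb R[x,\bar y_0,\bar y]$ with $p'=q_0+\sum_{i=1}^n q_i\,y'_i$, and $q_i$ $(i\ge1)$ is the *stream partial derivative* of $p$ with respect to $y_i$. The *stream Jacobian* of $\mathcal E$ is the $n\times n$ matrix $\mathrm{SJ}(x,\bar y_0,\bar y)$ whose $(i,j)$ entry is the stream partial derivative of $p_i$ with respect to $y_j$. The classical Jacobian is $\nabla_{\bar y}\mathcal E=(\partial p_i/\partial y_j)_{i,j}$, and $\partial\mathcal E/\partial x=(\partial p_1/\partial x,\dots,\partial p_n/\partial x)$. **Theorem (stream IFT, classical version).** Let $\mathcal E=(p_1,\dots,p_n)\in\mathbb R[x,\bar y]^n$ and $\bar r_0\in\mathbb R^n$. 1. The matrix $(\nabla_{\bar y}\mathcal E)(0,\bar r_0)$ is invertible in $\mathbb R^{n\times n}$ if and only if $\mathrm{SJ}(0,\bar r_0,\bar r_0)$ is. 2. Suppose that $\mathcal E(0,\bar r_0)=0$ and that $(\nabla_{\bar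 y}\mathcal E)(0,\bar r_0)$ is invertible. Then there is a unique stream solution $\bar\sigma$ of $\mathcal E$ with $\bar\sigma(0)=\bar r_0$. Moreover there is a function $f:\mathbb R\to\mathbb R^n$, real analytic at the origin, with $f(0)=\bar r_0$, such that * $\mathcal E(x,f(x))=0$ for all $x$ in a neighbourhood of $0$, and every $g:\mathbb R\to\mathbb R^n$, real analytic at the origin, with $g(0)=\bar r_0$ and $\mathcal E(x,g(x))=0$ near $0$ coincides with $f$ near $0$; * for all $x$ in a neighbourhood of $0$, $(\nabla_{\bar y}\mathcal E)(x,f(x))$ is invertible, $f$ is differentiable at $x$, and $$f'(x)=-(\nabla_{\bar y}\mathcal E)(x,f(x))^{-1}\left(\frac{\partial\mathcal E}{\partial x}(x,f(x))\right)^T,$$ and every $g:\mathbb R\to\mathbb R^n$ with $g(0)=\bar r_0$ that satisfies these conditions (with $g$ in place of $f$) in a neighbourhood of $0$ coincides with $f$ near $0$; * $\bar\sigma$ is the stream of Taylor coefficients of $f$ at $0$: $\sigma_i(j)=f_i^{(j)}(0)/j!$ for all $1\le i\le n$ and $j\ge0$. -/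

import Mathlib

open Filter Topology

noncomputable section

namespace StreamIFT

open MvPolynomial

/-- The ring `K[x, y₁, …, yₙ]`. The indeterminate `0` is `x` (also called `y₀`) and the
indeterminate `i.succ` is `yᵢ`; the order of `Fin (n + 1)` is the order `x < y₁ < ⋯ < yₙ`. -/
abbrev Poly (n : ℕ) (K : Type*) [CommRing K] := MvPolynomial (Fin (n + 1)) K

/-- The ring `K[x, y₀₁, …, y₀ₙ, y₁, …, yₙ]`. The indeterminates `Sum.inl v` are
`x, y₁, …, yₙ` (numbered as in `Poly`), and `Sum.inr i` is the initial value indeterminate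
`y₀ᵢ`. -/
abbrev InitPoly (n : ℕ) (K : Type*) [CommRing K] := MvPolynomial (Fin (n + 1) ⊕ Fin n) K

/-- The ring `K[x, y₀₁, …, y₀ₙ, y₁, …, yₙ, y'₁, …, y'ₙ]`, seen as the ring of polynomials in
the primed indeterminates `y'ᵢ` over `InitPoly n K`. -/
abbrev PrimedPoly (n : ℕ) (K : Type*) [CommRing K] := MvPolynomial (Fin n) (InitPoly n K)

variable {n : ℕ} {K : Type*} [CommRing K]

/-- The syntactic derivative of a single indeterminate: `x' = 1` and `(yᵢ)' = y'ᵢ`. -/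
def primedVar (v : Fin (n + 1)) : PrimedPoly n K :=
  Fin.cases 1 (fun i => X i) v

/-- The initial value of a single indeterminate: `0` for `x`, and `y₀ᵢ` for `yᵢ`. -/
def initVar (v : Fin (n + 1)) : InitPoly n K :=
  Fin.cases 0 (fun i => X (Sum.inr i)) v

/-- The syntactic stream derivative of the monomial `v₁ ⋯ vₖ` given by a list of
indeterminates: `1' = 0` and `(v · m)' = v' · m + v₀ · m'`. For `m = 1` the second rule
reads `(v)' = v'`. -/
def listDeriv : List (Fin (n + 1)) → PrimedPoly n K
  | [] => 0
  | v :: m =>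
      primedVar v * C (m.map fun w => (X (Sum.inl w) : InitPoly n K)).prod
        + C (initVar v) * listDeriv m

/-- The syntactic stream derivative: on a monomial, list its indeterminates (with
multiplicity) in increasing order and apply `listDeriv`; extend linearly. -/
def streamDeriv : Poly n K →ₗ[K] PrimedPoly n K :=
  (basisMonomials (Fin (n + 1)) K).constr K
    fun m => listDeriv ((Finsupp.toMultiset m).sort (· ≤ ·))

/-- The stream partial derivative with respect to `x`: the part of `streamDeriv p` that is free
of primed indeterminates. -/
def streamPartialX (p : Poly n K) : InitPoly n K := (streamDeriv p).coeff 0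

/-- The stream partial derivative with respect to `yᵢ`: the coefficient of `y'ᵢ` in
`streamDeriv p`. -/
def streamPartial (i : Fin n) (p : Poly n K) : InitPoly n K :=
  (streamDeriv p).coeff (Finsupp.single i 1)

/-- The coefficients of a polynomial that is affine in the primed indeterminates. -/
theorem affine_unique {q : PrimedPoly n K} {a : InitPoly n K} {b : Fin n → InitPoly n K}
    (h : q = C a + ∑ i, C (b i) * X i) :
    a = q.coeff 0 ∧ ∀ i, b i = q.coeff (Finsupp.single i 1) := by
  classical
  subst h
  constructor
  · simp [coeff_sum, coeff_C_mul, coeff_zero_X]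
  · intro i
    simp [coeff_sum, coeff_C_mul, coeff_X, coeff_C, Finsupp.single_left_inj,
      eq_comm (a := (0 : Fin n →₀ ℕ))]

theorem listDeriv_affine (l : List (Fin (n + 1))) :
    ∃ (a : InitPoly n K) (b : Fin n → InitPoly n K),
      (listDeriv l : PrimedPoly n K) = C a + ∑ i, C (b i) * X i := by
  classical
  induction l with
  | nil => exact ⟨0, 0, by simp [listDeriv]⟩
  | cons v m ih =>
    obtain ⟨a, b, h⟩ := ih
    set M : InitPoly n K := (m.map fun w => (X (Sum.inl w) : InitPoly n K)).prod with hM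
    refine Fin.cases ?_ (fun j => ?_) v
    · refine ⟨M, 0, ?_⟩
      simp [listDeriv, primedVar, initVar, ← hM]
    · refine ⟨X (Sum.inr j) * a, fun i => (if i = j then M else 0) + X (Sum.inr j) * b i, ?_⟩
      simp only [listDeriv, primedVar, initVar, ← hM, h, Fin.cases_succ, C_mul, C_add, add_mul,
        Finset.sum_add_distrib, apply_ite C, C_0, ite_mul, zero_mul, Finset.sum_ite_eq',
        Finset.mem_univ, if_true, mul_add, Finset.mul_sum]
      simp only [mul_assoc]
      ring

theorem streamDeriv_affine (p : Poly n K) :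
    ∃ (a : InitPoly n K) (b : Fin n → InitPoly n K),
      streamDeriv p = C a + ∑ i, C (b i) * X i := by
  induction p using MvPolynomial.induction_on' with
  | monomial m r =>
    obtain ⟨a, b, h⟩ := listDeriv_affine (K := K) ((Finsupp.toMultiset m).sort (· ≤ ·))
    refine ⟨r • a, fun i => r • b i, ?_⟩
    have e : (monomial m r : Poly n K) = r • basisMonomials (Fin (n + 1)) K m := by
      simp [smul_monomial]
    have hs : ∀ c : InitPoly n K, (C (r • c) : PrimedPoly n K) = r • C c := fun c => by
      rw [smul_eq_C_mul, C_mul, Algebra.smul_def]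
      rfl
    rw [e, map_smul, streamDeriv, Module.Basis.constr_basis, h]
    simp [hs, smul_add, Finset.smul_sum]
  | add p q hp hq =>
    obtain ⟨a, b, h⟩ := hp
    obtain ⟨a', b', h'⟩ := hq
    refine ⟨a + a', fun i => b i + b' i, ?_⟩
    rw [map_add, h, h']
    simp only [C_add, add_mul, Finset.sum_add_distrib]
    ring

/-- The stream partial derivatives of `p` are the unique polynomials `q₀, q₁, …, qₙ` in
`K[x, y₀₁, …, y₀ₙ, y₁, …, yₙ]` with `p' = q₀ + ∑ᵢ qᵢ y'ᵢ`. -/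
theorem streamDeriv_eq_iff (p : Poly n K) (q₀ : InitPoly n K) (q : Fin n → InitPoly n K) :
    streamDeriv p = C q₀ + ∑ i, C (q i) * X i ↔
      q₀ = streamPartialX p ∧ ∀ i, q i = streamPartial i p := by
  constructor
  · exact fun h => affine_unique h
  · obtain ⟨a, b, h⟩ := streamDeriv_affine p
    obtain ⟨ha, hb⟩ := affine_unique h
    rintro ⟨h₀, h₁⟩
    have e : q = b := funext fun i => (h₁ i).trans (hb i).symm
    rw [h, h₀, e, ha, streamPartialX]

/-- The stream Jacobian of `E = (p₁, …, pₙ)`, a matrix of polynomials. -/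
def streamJacobian (E : Fin n → Poly n K) : Matrix (Fin n) (Fin n) (InitPoly n K) :=
  Matrix.of fun i j => streamPartial j (E i)

/-- The value of the stream Jacobian at `(x, y₀, y)`. -/
def streamJacobianAt (E : Fin n → Poly n K) (x : K) (y₀ y : Fin n → K) :
    Matrix (Fin n) (Fin n) K :=
  (streamJacobian E).map (eval (Sum.elim (Fin.cons x y) y₀))

/-- The value `E(x, y)` of a system of polynomials. -/
def evalAt (E : Fin n → Poly n K) (x : K) (y : Fin n → K) : Fin n → K :=
  fun i => eval (Fin.cons x y) (E i)

/-- The value at `(x, y)` of the classical Jacobian of `E` with respect to `y₁, …, yₙ`. -/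
def classicalJacobianAt (E : Fin n → Poly n K) (x : K) (y : Fin n → K) :
    Matrix (Fin n) (Fin n) K :=
  Matrix.of fun i j => eval (Fin.cons x y) (pderiv j.succ (E i))

/-- The value at `(x, y)` of the vector of classical partial derivatives of `E` with respect
to `x`. -/
def classicalPartialXAt (E : Fin n → Poly n K) (x : K) (y : Fin n → K) : Fin n → K :=
  fun i => eval (Fin.cons x y) (pderiv 0 (E i))

/-- Streams over `K`, with the convolution product, are Mathlib's `PowerSeries K`. A tuple of
streams `σ` is a stream solution of `E` if `p(X, σ) = 0` for each `p` in `E`. -/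
def IsStreamSolution (E : Fin n → Poly n K) (σ : Fin n → PowerSeries K) : Prop :=
  ∀ i, aeval (Fin.cons (PowerSeries.X : PowerSeries K) σ) (E i) = 0

/-- `σ(0) = r`, componentwise. -/
def HasInitialValue (σ : Fin n → PowerSeries K) (r : Fin n → K) : Prop :=
  ∀ i, PowerSeries.coeff 0 (σ i) = r i

/-- The tuple of streams of Taylor coefficients at `0` of the components of `f`. -/
def taylorStream (f : ℝ → Fin n → ℝ) : Fin n → PowerSeries ℝ :=
  fun i => PowerSeries.mk fun j => iteratedDeriv j (fun x => f x i) 0 / (j.factorial : ℝ)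

/-- `f` is an implicit function of `E` at `(0, r)`, real analytic at the origin. -/
def IsAnalyticImplicitFunction (E : Fin n → Poly n ℝ) (r : Fin n → ℝ) (f : ℝ → Fin n → ℝ) :
    Prop :=
  AnalyticAt ℝ f 0 ∧ f 0 = r ∧ ∀ᶠ x in 𝓝 (0 : ℝ), evalAt E x (f x) = 0

/-- `f` is a solution, around the origin, of the initial value problem
`f'(x) = -(∇_y E)(x, f(x))⁻¹ · (∂E/∂x)(x, f(x))ᵀ`, `f(0) = r`. -/
def IsLocalODESolution (E : Fin n → Poly n ℝ) (r : Fin n → ℝ) (f : ℝ → Fin n → ℝ) : Prop :=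
  f 0 = r ∧ ∀ᶠ x in 𝓝 (0 : ℝ),
    IsUnit (classicalJacobianAt E x (f x)) ∧
      HasDerivAt f
        (-((classicalJacobianAt E x (f x))⁻¹.mulVec (classicalPartialXAt E x (f x)))) x

end StreamIFT

end

/-! Setting `x = 0` and `y = y₀ = r` turns the stream product rule into the Leibniz rule, so the two
Jacobians agree there and part 1 is immediate.

For part 2, the analytic implicit function theorem describes the zero set near `(0, r)` as the graph
of an analytic `f`. Taylor expansion at `0` respects sums and products, so the Taylor stream of `f`
is a stream solution; no formal recursion is needed for existence. If `σ`, `τ` are stream solutions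
starting at `r`, an exact first order expansion gives `M (σ - τ) = 0`, where the constant term of
`M` is the Jacobian at `(0, r)`. Hence `M` is invertible over power series and `σ = τ`.

Differentiating `E(x, f(x)) = 0` gives the differential equation. Conversely, the equation makes
`E(x, g(x))` constant, so its solutions lie on the graph of `f`; both uniqueness claims for
functions thus reduce to the graph description. -/

namespace StreamIFT

open MvPolynomial

/-! ### Stream and classical Jacobians at the initial point -/

section Jacobian

variable {n : ℕ} {K : Type*} [CommRing K]

/-- At `x = 0` and `y = y₀` the stream product rule is the Leibniz rule. -/
theorem eval_coeff_listDeriv (r : Fin n → K) (j : Fin n) (l : List (Fin (n + 1))) :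
    eval (Sum.elim (Fin.cons 0 r) r)
        ((listDeriv l : PrimedPoly n K).coeff (Finsupp.single j 1)) =
      eval (Fin.cons 0 r) (pderiv j.succ (l.map X).prod) := by
  classical
  induction l with
  | nil => simp [listDeriv]
  | cons v m ih =>
    have hM : eval (Sum.elim (Fin.cons 0 r) r)
        (m.map fun w => (X (Sum.inl w) : InitPoly n K)).prod =
        eval (Fin.cons 0 r : Fin (n + 1) → K) (m.map X).prod := by
      simp [map_list_prod, Function.comp_def]
    have hv : eval (Sum.elim (Fin.cons 0 r) r)
        ((primedVar v : PrimedPoly n K).coeff (Finsupp.single j 1)) =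
        eval (Fin.cons 0 r : Fin (n + 1) → K) (pderiv j.succ (X v)) := by
      refine Fin.cases ?_ (fun i => ?_) v
      · simp [primedVar, coeff_one, pderiv_X, eq_comm (a := (0 : Fin n →₀ ℕ)),
          (Fin.succ_ne_zero j).symm]
      · by_cases h : i = j <;>
          simp [primedVar, coeff_X, pderiv_X, h, Finsupp.single_left_inj]
    have hi : eval (Sum.elim (Fin.cons 0 r) r) (initVar v : InitPoly n K) =
        (Fin.cons 0 r : Fin (n + 1) → K) v := by
      refine Fin.cases ?_ (fun i => ?_) v <;> simp [initVar]
    rw [listDeriv, mul_comm (primedVar v)]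
    simp only [coeff_add, coeff_C_mul, map_add, map_mul, hM, hv, hi, ih,
      List.map_cons, List.prod_cons, Derivation.leibniz, smul_eq_mul, eval_X]
    ring

theorem eval_streamPartial (r : Fin n → K) (j : Fin n) (p : Poly n K) :
    eval (Sum.elim (Fin.cons 0 r) r) (streamPartial j p) =
      eval (Fin.cons 0 r) (pderiv j.succ p) := by
  induction p using MvPolynomial.induction_on' with
  | monomial m a =>
    have e : (monomial m a : Poly n K) = a • basisMonomials (Fin (n + 1)) K m := by
      simp [smul_monomial]
    -- The Leibniz rule holds for any list of variables, so all that matters about the sorted list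
    -- is that its product is the monomial.
    have hm : (basisMonomials (Fin (n + 1)) K m : Poly n K) =
        (((Finsupp.toMultiset m).sort (· ≤ ·)).map X).prod := by
      rw [← Multiset.prod_coe, ← Multiset.map_coe, Multiset.sort_eq, Finsupp.toMultiset_map,
        Finsupp.prod_toMultiset]
      simp [monomial_eq, Finsupp.prod_mapDomain_index, pow_add]
    rw [streamPartial, e, map_smul, streamDeriv, Module.Basis.constr_basis, coeff_smul,
      smul_eval, Derivation.map_smul, smul_eval, eval_coeff_listDeriv, ← hm]
  | add p q hp hq =>
    simp only [streamPartial, map_add, coeff_add] at hp hq ⊢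
    rw [hp, hq]

theorem streamJacobianAt_zero_self (E : Fin n → Poly n K) (r : Fin n → K) :
    streamJacobianAt E 0 r r = classicalJacobianAt E 0 r := by
  ext i j
  simp [streamJacobianAt, streamJacobian, classicalJacobianAt, eval_streamPartial]

end Jacobian

/-! ### Uniqueness of stream solutions -/

section FormalUniqueness

variable {n : ℕ} {K : Type*} [CommRing K]

/-- A first order Taylor formula with exact remainder, for polynomials in power series. -/
theorem exists_aeval_sub_eq_sum {ι : Type*} [Fintype ι] (s t : ι → PowerSeries K)
    (hst : ∀ v, PowerSeries.constantCoeff (s v) = PowerSeries.constantCoeff (t v))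
    (p : MvPolynomial ι K) :
    ∃ m : ι → PowerSeries K, aeval s p - aeval t p = ∑ v, m v * (s v - t v) ∧
      ∀ v, PowerSeries.constantCoeff (m v) =
        eval (fun v => PowerSeries.constantCoeff (t v)) (pderiv v p) := by
  classical
  induction p using MvPolynomial.induction_on with
  | C a => exact ⟨0, by simp⟩
  | add p q hp hq =>
    obtain ⟨a, ha, ha'⟩ := hp
    obtain ⟨b, hb, hb'⟩ := hq
    refine ⟨a + b, ?_, fun v => by simp [ha', hb']⟩
    simp only [map_add, Pi.add_apply, add_mul, Finset.sum_add_distrib, ← ha, ← hb]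
    ring
  | mul_X p w hp =>
    obtain ⟨a, ha, ha'⟩ := hp
    -- From `p(s) s_w - p(t) t_w = (p(s) - p(t)) s_w + p(t) (s_w - t_w)`.
    refine ⟨fun v => a v * s w + if v = w then aeval t p else 0, ?_, fun v => ?_⟩
    · have : ∑ v, a v * s w * (s v - t v) = (∑ v, a v * (s v - t v)) * s w := by
        rw [Finset.sum_mul]
        exact Finset.sum_congr rfl fun v _ => by ring
      simp only [add_mul, Finset.sum_add_distrib, this, ← ha, ite_mul, zero_mul,
        Finset.sum_ite_eq', Finset.mem_univ, if_true, map_mul, aeval_X]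
      ring
    · by_cases h : v = w
      · subst h
        simp [ha', hst]
        ring
      · simp [ha', hst, h, pderiv_X_of_ne (Ne.symm h)]
        ring

/-- Stream solutions are determined by their initial value where the Jacobian is invertible. -/
theorem IsStreamSolution.eq_of_hasInitialValue {E : Fin n → Poly n K} {r : Fin n → K}
    (hJ : IsUnit (classicalJacobianAt E 0 r)) {σ τ : Fin n → PowerSeries K}
    (hσ : IsStreamSolution E σ) (hσr : HasInitialValue σ r)
    (hτ : IsStreamSolution E τ) (hτr : HasInitialValue τ r) : σ = τ := by
  have hconst : (fun v => PowerSeries.constantCoeff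
      ((Fin.cons PowerSeries.X τ : Fin (n + 1) → PowerSeries K) v)) = Fin.cons 0 r := by
    ext v
    refine Fin.cases ?_ (fun i => ?_) v
    · simp
    · simpa using hτr i
  have hst : ∀ v, PowerSeries.constantCoeff
      ((Fin.cons PowerSeries.X σ : Fin (n + 1) → PowerSeries K) v) =
      PowerSeries.constantCoeff ((Fin.cons PowerSeries.X τ : Fin (n + 1) → PowerSeries K) v) := by
    intro v
    refine Fin.cases rfl (fun i => ?_) v
    simpa using (hσr i).trans (hτr i).symm
  choose m hm hm' using fun i => exists_aeval_sub_eq_sum _ _ hst (E i)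
  let M : Matrix (Fin n) (Fin n) (PowerSeries K) := Matrix.of fun i j => m i j.succ
  have hM : M.map PowerSeries.constantCoeff = classicalJacobianAt E 0 r := by
    ext i j
    simp [M, hm', hconst, classicalJacobianAt]
  have hMu : IsUnit M := by
    rw [Matrix.isUnit_iff_isUnit_det, PowerSeries.isUnit_iff_constantCoeff, RingHom.map_det]
    rw [← hM] at hJ
    exact (Matrix.isUnit_iff_isUnit_det _).1 hJ
  -- The term of index `0` drops out because both tuples have `X` in that slot.
  have h0 : M.mulVec (σ - τ) = 0 := by
    ext1 i
    have h := hm i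
    rw [hσ i, hτ i, Fin.sum_univ_succ] at h
    simpa [M, Matrix.mulVec, dotProduct] using h.symm
  have := Matrix.mulVec_injective_of_isUnit hMu (h0.trans (Matrix.mulVec_zero M).symm)
  exact sub_eq_zero.1 this

end FormalUniqueness

/-! ### Taylor expansion as an algebra homomorphism -/

section Taylor

/-- The power series of Taylor coefficients at `0` of a function. -/
noncomputable def taylorSeriesAtZero (f : ℝ → ℝ) : PowerSeries ℝ :=
  PowerSeries.mk fun j => iteratedDeriv j f 0 / (j.factorial : ℝ)

theorem taylorSeriesAtZero_congr {f g : ℝ → ℝ} (h : f =ᶠ[𝓝 0] g) :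
    taylorSeriesAtZero f = taylorSeriesAtZero g := by
  ext j
  simp [taylorSeriesAtZero, h.iteratedDeriv_eq]

theorem taylorSeriesAtZero_const (c : ℝ) :
    taylorSeriesAtZero (fun _ => c) = PowerSeries.C c := by
  ext j
  by_cases h : j = 0 <;> simp [taylorSeriesAtZero, iteratedDeriv_const, PowerSeries.coeff_C, h]

theorem taylorSeriesAtZero_id : taylorSeriesAtZero (fun x => x) = PowerSeries.X := by
  ext j
  rcases j with _ | _ | j
  · simp [taylorSeriesAtZero]
  · simp [taylorSeriesAtZero, iteratedDeriv_one]
  · simp [taylorSeriesAtZero, PowerSeries.coeff_X, iteratedDeriv_succ', deriv_id'',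
      iteratedDeriv_const]

theorem taylorSeriesAtZero_add {f g : ℝ → ℝ} (hf : AnalyticAt ℝ f 0) (hg : AnalyticAt ℝ g 0) :
    taylorSeriesAtZero (fun x => f x + g x) = taylorSeriesAtZero f + taylorSeriesAtZero g := by
  ext j
  simp [taylorSeriesAtZero, iteratedDeriv_fun_add hf.contDiffAt hg.contDiffAt, add_div]

/-- Division by `j!` absorbs the binomial coefficients of the higher Leibniz rule, leaving the
convolution product. -/
theorem taylorSeriesAtZero_mul {f g : ℝ → ℝ} (hf : AnalyticAt ℝ f 0) (hg : AnalyticAt ℝ g 0) :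
    taylorSeriesAtZero (fun x => f x * g x) = taylorSeriesAtZero f * taylorSeriesAtZero g := by
  ext j
  simp only [taylorSeriesAtZero, PowerSeries.coeff_mk, PowerSeries.coeff_mul,
    iteratedDeriv_fun_mul hf.contDiffAt hg.contDiffAt, Finset.sum_div,
    Finset.Nat.sum_antidiagonal_eq_sum_range_succ_mk]
  refine Finset.sum_congr rfl fun i hi => ?_
  have hij : i ≤ j := Nat.lt_succ_iff.1 (Finset.mem_range.1 hi)
  rw [Nat.cast_choose ℝ hij]
  field_simp

theorem taylorSeriesAtZero_eval {ι : Type*} {h : ℝ → ι → ℝ}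
    (hh : ∀ v, AnalyticAt ℝ (fun x => h x v) 0) (p : MvPolynomial ι ℝ) :
    AnalyticAt ℝ (fun x => eval (h x) p) 0 ∧
      taylorSeriesAtZero (fun x => eval (h x) p) =
        aeval (fun v => taylorSeriesAtZero fun x => h x v) p := by
  induction p using MvPolynomial.induction_on with
  | C a => exact ⟨by simpa using analyticAt_const, by
      simp [taylorSeriesAtZero_const]⟩
  | add p q hp hq =>
    simp only [map_add]
    exact ⟨hp.1.add hq.1, by rw [taylorSeriesAtZero_add hp.1 hq.1, hp.2, hq.2]⟩
  | mul_X p v hp =>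
    simp only [map_mul, eval_X, aeval_X]
    exact ⟨hp.1.mul (hh v), by rw [taylorSeriesAtZero_mul hp.1 (hh v), hp.2]⟩

variable {n : ℕ} {E : Fin n → Poly n ℝ} {r : Fin n → ℝ} {f : ℝ → Fin n → ℝ}

theorem IsAnalyticImplicitFunction.isStreamSolution (hf : IsAnalyticImplicitFunction E r f) :
    IsStreamSolution E (taylorStream f) := by
  intro i
  have hh : ∀ v, AnalyticAt ℝ (fun x => (Fin.cons x (f x) : Fin (n + 1) → ℝ) v) 0 := by
    intro v
    refine Fin.cases ?_ (fun j => ?_) v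
    · exact analyticAt_id
    · simpa using (analyticAt_pi_iff.1 hf.1) j
  have hs : (fun v => taylorSeriesAtZero fun x => (Fin.cons x (f x) : Fin (n + 1) → ℝ) v) =
      Fin.cons PowerSeries.X (taylorStream f) := by
    ext1 v
    refine Fin.cases ?_ (fun j => ?_) v
    · simpa using taylorSeriesAtZero_id
    · simp [taylorStream, taylorSeriesAtZero]
  rw [← hs, ← (taylorSeriesAtZero_eval hh (E i)).2]
  have h0 : (fun x => eval (Fin.cons x (f x) : Fin (n + 1) → ℝ) (E i)) =ᶠ[𝓝 0] fun _ => 0 :=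
    hf.2.2.mono fun x hx => congrFun hx i
  rw [taylorSeriesAtZero_congr h0, taylorSeriesAtZero_const, map_zero]

theorem IsAnalyticImplicitFunction.hasInitialValue (hf : IsAnalyticImplicitFunction E r f) :
    HasInitialValue (taylorStream f) r := by
  intro i
  simp [taylorStream, hf.2.1]

end Taylor

/-! ### The analytic implicit function and its differential equation -/

section Implicit

open scoped ContDiff

theorem hasFDerivAt_eval {ι : Type*} [Fintype ι] (p : MvPolynomial ι ℝ) (w : ι → ℝ) :
    HasFDerivAt (fun w => eval w p)
      (∑ v, eval w (pderiv v p) • (ContinuousLinearMap.proj v : (ι → ℝ) →L[ℝ] ℝ)) w := by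
  classical
  induction p using MvPolynomial.induction_on with
  | C a => simpa using hasFDerivAt_const a w
  | add p q hp hq => 
    simp only [map_add, add_smul, Finset.sum_add_distrib]
    exact hp.add hq
  | mul_X p i hp =>
    have h := hp.mul (ContinuousLinearMap.proj (R := ℝ) (φ := fun _ : ι => ℝ) i).hasFDerivAt
    simp only [map_mul, eval_X]
    refine h.congr_fderiv ?_
    ext u
    simp [pderiv_X, Pi.single_apply, add_mul, Finset.sum_add_distrib, Finset.mul_sum,
      apply_ite (eval w), mul_assoc]

variable {n : ℕ} {E : Fin n → Poly n ℝ} {r : Fin n → ℝ} {f g : ℝ → Fin n → ℝ}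

/-- The coordinates `(x, y) ↦ Fin.cons x y`, as a continuous linear map. -/
noncomputable def consCLM (n : ℕ) : ℝ × (Fin n → ℝ) →L[ℝ] (Fin (n + 1) → ℝ) :=
  ContinuousLinearMap.pi fun v => Fin.cases (ContinuousLinearMap.fst ℝ ℝ (Fin n → ℝ))
    (fun i => (ContinuousLinearMap.proj i).comp (ContinuousLinearMap.snd ℝ ℝ (Fin n → ℝ))) v

theorem consCLM_apply (u : ℝ × (Fin n → ℝ)) : consCLM n u = Fin.cons u.1 u.2 := by
  ext v
  refine Fin.cases ?_ (fun i => ?_) v <;> simp [consCLM]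

/-- The total derivative of `E` at `(x, y)`. -/
noncomputable def totalDerivAt (E : Fin n → Poly n ℝ) (u : ℝ × (Fin n → ℝ)) :
    ℝ × (Fin n → ℝ) →L[ℝ] (Fin n → ℝ) :=
  (ContinuousLinearMap.fst ℝ ℝ (Fin n → ℝ)).smulRight (classicalPartialXAt E u.1 u.2) +
    (Matrix.mulVecLin (classicalJacobianAt E u.1 u.2)).toContinuousLinearMap.comp
      (ContinuousLinearMap.snd ℝ ℝ (Fin n → ℝ))

theorem totalDerivAt_apply (E : Fin n → Poly n ℝ) (u w : ℝ × (Fin n → ℝ)) :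
    totalDerivAt E u w = w.1 • classicalPartialXAt E u.1 u.2 +
      (classicalJacobianAt E u.1 u.2).mulVec w.2 := by
  simp [totalDerivAt]

theorem hasFDerivAt_evalAt (E : Fin n → Poly n ℝ) (u : ℝ × (Fin n → ℝ)) :
    HasFDerivAt (fun u : ℝ × (Fin n → ℝ) => evalAt E u.1 u.2) (totalDerivAt E u) u := by
  rw [hasFDerivAt_pi']
  intro i
  have h := (hasFDerivAt_eval (E i) (consCLM n u)).comp u (consCLM n).hasFDerivAt
  simp only [Function.comp_def, consCLM_apply] at h
  refine h.congr_fderiv ?_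
  refine ContinuousLinearMap.ext fun w => ?_
  simp [totalDerivAt_apply, Fin.sum_univ_succ, consCLM_apply, classicalPartialXAt,
    classicalJacobianAt, Matrix.mulVec, dotProduct, mul_comm]

theorem contDiff_evalAt (E : Fin n → Poly n ℝ) :
    ContDiff ℝ ω fun u : ℝ × (Fin n → ℝ) => evalAt E u.1 u.2 := by
  refine contDiff_pi.2 fun i => ?_
  have h : ContDiff ℝ ω fun w : Fin (n + 1) → ℝ => eval w (E i) :=
    contDiff_iff_contDiffAt.2 fun w =>
      ((AnalyticOnNhd.eval_mvPolynomial (E i)) w (Set.mem_univ w)).contDiffAt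
  simpa [Function.comp_def, consCLM_apply, evalAt] using h.comp (consCLM n).contDiff

theorem continuous_classicalJacobianAt (E : Fin n → Poly n ℝ) :
    Continuous fun u : ℝ × (Fin n → ℝ) => classicalJacobianAt E u.1 u.2 := by
  refine continuous_matrix fun i j => ?_
  have h := (MvPolynomial.continuous_eval (pderiv j.succ (E i))).comp (consCLM n).continuous
  simpa [Function.comp_def, consCLM_apply, classicalJacobianAt] using h

/-- Restricted to the `y` directions the total derivative is the classical Jacobian; this is the
hypothesis of the implicit function theorem. -/
theorem isInvertible_totalDerivAt_comp_inr {u : ℝ × (Fin n → ℝ)}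
    (hJ : IsUnit (classicalJacobianAt E u.1 u.2)) :
    (totalDerivAt E u ∘L .inr ℝ ℝ (Fin n → ℝ)).IsInvertible := by
  have h : Function.Bijective (Matrix.mulVecLin (classicalJacobianAt E u.1 u.2)) :=
    ⟨Matrix.mulVec_injective_of_isUnit hJ, Matrix.mulVec_surjective_iff_isUnit.2 hJ⟩
  refine ⟨(LinearEquiv.ofBijective _ h).toContinuousLinearEquiv, ?_⟩
  ext1 w
  simp [totalDerivAt_apply]

/-- Near `(0, r)` the zero set of `E` is the graph of an analytic function. -/
theorem exists_analytic_graph (h0 : evalAt E 0 r = 0) (hJ : IsUnit (classicalJacobianAt E 0 r)) :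
    ∃ f, IsAnalyticImplicitFunction E r f ∧
      ∀ᶠ u in 𝓝 ((0 : ℝ), r), evalAt E u.1 u.2 = 0 ↔ f u.1 = u.2 := by
  have cdf : ContDiffAt ℝ ω (fun u : ℝ × (Fin n → ℝ) => evalAt E u.1 u.2) ((0 : ℝ), r) :=
    (contDiff_evalAt E).contDiffAt
  have pn : (ω : WithTop ℕ∞) ≠ 0 := by simp
  have hinv : (fderiv ℝ (fun u : ℝ × (Fin n → ℝ) => evalAt E u.1 u.2) ((0 : ℝ), r) ∘L
      .inr ℝ ℝ (Fin n → ℝ)).IsInvertible := by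
    rw [(hasFDerivAt_evalAt E _).fderiv]
    exact isInvertible_totalDerivAt_comp_inr hJ
  refine ⟨cdf.implicitFunction pn hinv,
    ⟨(cdf.contDiffAt_implicitFunction pn hinv).analyticAt,
      cdf.implicitFunction_apply_self pn hinv, ?_⟩, ?_⟩
  · simpa [h0] using cdf.eventually_apply_implicitFunction pn hinv
  · simpa [h0] using cdf.eventually_apply_eq_iff_implicitFunction pn hinv

theorem hasDerivAt_evalAt_comp {x : ℝ} {f' : Fin n → ℝ} (hf : HasDerivAt f f' x) :
    HasDerivAt (fun x => evalAt E x (f x)) (classicalPartialXAt E x (f x) +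
      (classicalJacobianAt E x (f x)).mulVec f') x := by
  have h := (hasFDerivAt_evalAt E (x, f x)).comp_hasDerivAt x ((hasDerivAt_id x).prodMk hf)
  simpa [totalDerivAt_apply, Function.comp_def] using h

theorem IsAnalyticImplicitFunction.isLocalODESolution (hf : IsAnalyticImplicitFunction E r f)
    (hJ : IsUnit (classicalJacobianAt E 0 r)) : IsLocalODESolution E r f := by
  obtain ⟨hfa, hfr, hfE⟩ := hf
  refine ⟨hfr, ?_⟩
  have hcont : ContinuousAt (fun x => (classicalJacobianAt E x (f x)).det) 0 :=
    ((continuous_classicalJacobianAt E).matrix_det.continuousAt (x := ((0 : ℝ), f 0))).comp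
      (f := fun x => (x, f x)) (continuousAt_id.prodMk hfa.continuousAt)
  have hdet : (classicalJacobianAt E 0 (f 0)).det ≠ 0 := by
    rw [hfr]
    exact ((Matrix.isUnit_iff_isUnit_det _).1 hJ).ne_zero
  -- `eventually_nhds` gives the equation on a whole neighbourhood of each such `x`, so it can be
  -- differentiated there.
  filter_upwards [hcont.eventually_ne hdet, hfa.eventually_analyticAt,
    hfE.eventually_nhds] with x hx hxa hxE
  have hu : IsUnit (classicalJacobianAt E x (f x)) :=
    (Matrix.isUnit_iff_isUnit_det _).2 hx.isUnit
  refine ⟨hu, ?_⟩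
  have hd := hxa.differentiableAt.hasDerivAt
  have h0 : classicalPartialXAt E x (f x) + (classicalJacobianAt E x (f x)).mulVec (deriv f x) =
      0 :=
    (hasDerivAt_evalAt_comp hd).unique
      ((hasDerivAt_const x (0 : Fin n → ℝ)).congr_of_eventuallyEq hxE)
  convert! hd using 1
  rw [eq_neg_of_add_eq_zero_left h0, Matrix.mulVec_neg, neg_neg, Matrix.mulVec_mulVec,
    Matrix.nonsing_inv_mul _ ((Matrix.isUnit_iff_isUnit_det _).1 hu), Matrix.one_mulVec]

/-- By the chain rule the differential equation says that `E(x, g(x))` has zero derivative on a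
ball, so it keeps its value at the centre. -/
theorem IsLocalODESolution.eventually_evalAt_eq_zero (hg : IsLocalODESolution E r g)
    (h0 : evalAt E 0 r = 0) : ∀ᶠ x in 𝓝 (0 : ℝ), evalAt E x (g x) = 0 := by
  obtain ⟨hgr, hgE⟩ := hg
  obtain ⟨ε, hε, hball⟩ := Metric.eventually_nhds_iff_ball.1 hgE
  have hd : ∀ x ∈ Metric.ball (0 : ℝ) ε, HasDerivAt (fun x => evalAt E x (g x)) 0 x := by
    intro x hx
    obtain ⟨hu, hx⟩ := hball x hx
    convert hasDerivAt_evalAt_comp hx using 1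
    rw [Matrix.mulVec_neg, Matrix.mulVec_mulVec,
      Matrix.mul_nonsing_inv _ ((Matrix.isUnit_iff_isUnit_det _).1 hu), Matrix.one_mulVec,
      add_neg_cancel]
  filter_upwards [Metric.ball_mem_nhds (0 : ℝ) hε] with x hx
  have h := Metric.isOpen_ball.is_const_of_deriv_eq_zero
    (convex_ball (0 : ℝ) ε).isPreconnected
    (fun x hx => (hd x hx).differentiableAt.differentiableWithinAt)
    (fun x hx => (hd x hx).deriv) hx (Metric.mem_ball_self hε)
  simpa [hgr, h0] using h

end Implicit

end StreamIFT

theorem theorem4p2 (n : ℕ) (E : Fin n → StreamIFT.Poly n ℝ) (r₀ : Fin n → ℝ) :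
    (IsUnit (StreamIFT.classicalJacobianAt E 0 r₀) ↔
      IsUnit (StreamIFT.streamJacobianAt E 0 r₀ r₀)) ∧
    (StreamIFT.evalAt E 0 r₀ = 0 → IsUnit (StreamIFT.classicalJacobianAt E 0 r₀) →
      ∃ (σ : Fin n → PowerSeries ℝ) (f : ℝ → Fin n → ℝ),
        -- `σ` is the unique stream solution with `σ(0) = r₀`
        (StreamIFT.IsStreamSolution E σ ∧ StreamIFT.HasInitialValue σ r₀) ∧
        (∀ τ : Fin n → PowerSeries ℝ,
          StreamIFT.IsStreamSolution E τ → StreamIFT.HasInitialValue τ r₀ → τ = σ) ∧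
        -- `f` is the real analytic implicit function (unique as a germ at the origin)
        StreamIFT.IsAnalyticImplicitFunction E r₀ f ∧
        (∀ g : ℝ → Fin n → ℝ,
          StreamIFT.IsAnalyticImplicitFunction E r₀ g → g =ᶠ[𝓝 0] f) ∧
        -- `f` is the unique solution of the initial value problem around the origin
        StreamIFT.IsLocalODESolution E r₀ f ∧
        (∀ g : ℝ → Fin n → ℝ, StreamIFT.IsLocalODESolution E r₀ g → g =ᶠ[𝓝 0] f) ∧
        -- `σ` is the stream of Taylor coefficients of `f`
        σ = StreamIFT.taylorStream f) := by
  refine ⟨by rw [StreamIFT.streamJacobianAt_zero_self], fun h0 hJ => ?_⟩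
  obtain ⟨f, hf, hgraph⟩ := StreamIFT.exists_analytic_graph h0 hJ
  -- Continuity at `0` alone brings `(x, g x)` into the region where the zero set is the graph of
  -- `f`.
  have huniq : ∀ g : ℝ → Fin n → ℝ, ContinuousAt g 0 → g 0 = r₀ →
      (∀ᶠ x in 𝓝 (0 : ℝ), StreamIFT.evalAt E x (g x) = 0) → g =ᶠ[𝓝 0] f := by
    intro g hg hg0 hgE
    have ht : Tendsto (fun x => (x, g x)) (𝓝 0) (𝓝 ((0 : ℝ), r₀)) := by
      rw [← hg0]
      exact continuousAt_id.prodMk hg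
    filter_upwards [ht.eventually hgraph, hgE] with x hx hxE
    exact (hx.1 hxE).symm
  refine ⟨StreamIFT.taylorStream f, f, ⟨hf.isStreamSolution, hf.hasInitialValue⟩,
    fun τ hτ hτr => hτ.eq_of_hasInitialValue hJ hτr hf.isStreamSolution hf.hasInitialValue, hf,
    fun g hg => huniq g hg.1.continuousAt hg.2.1 hg.2.2, hf.isLocalODESolution hJ,
    -- The differential equation at `x = 0` itself supplies the continuity of `g`.
    fun g hg => huniq g hg.2.self_of_nhds.2.continuousAt hg.1 (hg.eventually_evalAt_eq_zero h0),
    rfl⟩
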